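/- Let $\mathcal{C}$ be a Frobenius exact category, i.e. an exact category (in the sense of Quillen) with enough injectives and enough projectives in which the injective and the projective objects coincide. Let $\underline{\mathcal{C}}$ be its stable category modulo projectives, with its usual triangulated structure: the suspension $X[1]=\Omega^{-1}X$ is given by conflations $0\to X\to I\to\Omega^{-1}X\to 0$ with $I$ injective, and the distinguished triangles are those isomorphic to a triangle $X\xrightarrow{f}Y\to K\to X[1]$ obtained by pushing out such a conflation along a morphism $f$ of $\mathcal{C}$. All full subcategories below are understood to be closed under isomorphism. For a full subcategory $\mathcal{F}$ of $\mathcal{C}$ let $\underline{\mathcal{F}}$ be its essential image in $\underline{\mathcal{C}}$, viewed also as a full subcategory of $\mathcal{C}$, since $\mathcal{C}$ and $\underline{\mathcal{C}}$ have the same objects. A *cotorsion pair* in $\mathcal{C}$ is a pair $(\mathcal{F},\mathcal{T})$ of full subcategories with $\mathcal{T}=\{Y\mid \operatorname{Ext}^1_{\mathcal{C}}(X,Y)=0\ \text{for all}\ X\in\mathcal{F}\}$ and $\mathcal{F}=\{X\mid \operatorname{Ext}^1_{\mathcal{C}}(X,Y)=0\ \text{for all}\ Y\in\mathcal{T}\}$.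 It is *complete* if for each $M\in\mathcal{C}$ there are conflations $0\to Y\to X\to M\to 0$ and $0\to M\to Y'\to X'\to 0$ with $X,X'\in\mathcal{F}$ and $Y,Y'\in\mathcal{T}$, and *hereditary* if for every conflation $0\to K\to P\to X\to 0$ with $P$ projective and $X\in\mathcal{F}$ one has $K\in\mathcal{F}$. A *weight structure* on a triangulated category $\mathcal{D}$ is a pair $(\mathcal{X},\mathcal{Y})$ of full subcategories such that 1. $\mathcal{X}[1]=\{M\mid \operatorname{Hom}_{\mathcal{D}}(Y,M)=0\ \text{for all}\ Y\in\mathcal{Y}\}$ and $\mathcal{Y}=\{M\mid \operatorname{Hom}_{\mathcal{D}}(M,X[1])=0\ \text{for all}\ X\in\mathcal{X}\}$; 2. $\mathcal{X}[1]\subseteq\mathcal{X}$; 3. each $M\in\mathcal{D}$ lies in a distinguished triangle $M\to X\to Y\to M[1]$ with $X\in\mathcal{X}$ and $Y\in\mathcal{Y}$. **Proposition.** For a pair $(\mathcal{F},\mathcal{T})$ of full subcategories of $\mathcal{C}$ the following are equivalent: 1. $(\underline{\mathcal{F}},\underline{\mathcal{T}})$ is a complete hereditary cotorsion pair in $\mathcal{C}$;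 2. $(\underline{\mathcal{T}},\underline{\mathcal{F}})$ is a weight structure on $\underline{\mathcal{C}}$. Moreover, the assignment $(\mathcal{F},\mathcal{T})\mapsto(\underline{\mathcal{T}},\underline{\mathcal{F}})$ is a bijection from the complete hereditary cotorsion pairs in $\mathcal{C}$ to the weight structures on $\underline{\mathcal{C}}$. -/

import Mathlib

open CategoryTheory CategoryTheory.Limits
open scoped ZeroObject

universe v u

/-! ### Exact categories -/

section Exact

variable {C : Type u} [Category.{v} C] [Preadditive C]

/-- A morphism `i` is an inflation (admissible monomorphism) with respect to a class of short
complexes if it is the first map of a member of the class. -/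
def IsInflationFor (conf : ObjectProperty (ShortComplex C)) {X Y : C} (i : X ⟶ Y) : Prop :=
  ∃ (Z : C) (p : Y ⟶ Z) (w : i ≫ p = 0), conf (ShortComplex.mk i p w)

/-- A morphism `p` is a deflation (admissible epimorphism) with respect to a class of short
complexes if it is the second map of a member of the class. -/
def IsDeflationFor (conf : ObjectProperty (ShortComplex C)) {Y Z : C} (p : Y ⟶ Z) : Prop :=
  ∃ (X : C) (i : X ⟶ Y) (w : i ≫ p = 0), conf (ShortComplex.mk i p w)

variable (C) in
/-- An exact structure (in the sense of Quillen) on an additive category: a class of kernel-cokernel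
pairs, closed under isomorphism, such that identities are inflations and deflations, inflations
and deflations are closed under composition, pushouts of inflations along arbitrary morphisms exist
and are inflations, and pullbacks of deflations along arbitrary morphisms exist and are
deflations. -/
structure ExactStructure where
  /-- the short complexes `0 ⟶ X ⟶ Y ⟶ Z ⟶ 0` that are conflations -/
  conflation : ObjectProperty (ShortComplex C)
  conflation_of_iso : ∀ {S S' : ShortComplex C}, (S ≅ S') → conflation S → conflation S'
  isKernel : ∀ {S : ShortComplex C}, conflation S → Nonempty (IsLimit (KernelFork.ofι S.f S.zero))
  isCokernel : ∀ {S : ShortComplex C}, conflation S →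
    Nonempty (IsColimit (CokernelCofork.ofπ S.g S.zero))
  inflation_id : ∀ X : C, IsInflationFor conflation (𝟙 X)
  deflation_id : ∀ X : C, IsDeflationFor conflation (𝟙 X)
  inflation_comp : ∀ {X Y Z : C} (i : X ⟶ Y) (j : Y ⟶ Z), IsInflationFor conflation i →
    IsInflationFor conflation j → IsInflationFor conflation (i ≫ j)
  deflation_comp : ∀ {X Y Z : C} (p : X ⟶ Y) (q : Y ⟶ Z), IsDeflationFor conflation p →
    IsDeflationFor conflation q → IsDeflationFor conflation (p ≫ q)
  inflation_pushout : ∀ {X Y X' : C} (i : X ⟶ Y) (f : X ⟶ X'), IsInflationFor conflation i →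
    ∃ (Y' : C) (f' : Y ⟶ Y') (i' : X' ⟶ Y'), IsPushout i f f' i' ∧ IsInflationFor conflation i'
  deflation_pullback : ∀ {Y Z Z' : C} (p : Y ⟶ Z) (f : Z' ⟶ Z), IsDeflationFor conflation p →
    ∃ (Y' : C) (f' : Y' ⟶ Y) (p' : Y' ⟶ Z'), IsPullback f' p' p f ∧ IsDeflationFor conflation p'

namespace ExactStructure

variable (E : ExactStructure C)

/-- Inflations of an exact structure. -/
abbrev Inflation {X Y : C} (i : X ⟶ Y) : Prop := IsInflationFor E.conflation i

/-- Deflations of an exact structure. -/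
abbrev Deflation {Y Z : C} (p : Y ⟶ Z) : Prop := IsDeflationFor E.conflation p

/-- `I` is injective if every inflation `I ⟶ Y` splits. -/
def IsInjective : ObjectProperty C :=
  fun I ↦ ∀ ⦃Y : C⦄ (i : I ⟶ Y), E.Inflation i → IsSplitMono i

/-- `P` is projective if every deflation `Y ⟶ P` splits. -/
def IsProjective : ObjectProperty C :=
  fun P ↦ ∀ ⦃Y : C⦄ (p : Y ⟶ P), E.Deflation p → IsSplitEpi p

/-- An exact category is Frobenius if it has enough injectives, enough projectives, and the
injective and the projective objects coincide. -/
structure IsFrobenius : Prop where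
  enough_injectives : ∀ X : C, ∃ (I : C) (i : X ⟶ I), E.IsInjective I ∧ E.Inflation i
  enough_projectives : ∀ X : C, ∃ (P : C) (p : P ⟶ X), E.IsProjective P ∧ E.Deflation p
  injective_eq_projective : E.IsInjective = E.IsProjective

/-! ### Yoneda Ext and cotorsion pairs -/

/-- Extensions of `X` by `Y`: conflations `0 ⟶ Y ⟶ Z ⟶ X ⟶ 0`. -/
structure Extension (X Y : C) where
  /-- the middle term -/
  mid : C
  /-- the inflation -/
  i : Y ⟶ mid
  /-- the deflation -/
  p : mid ⟶ X
  zero : i ≫ p = 0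
  conflation : E.conflation (ShortComplex.mk i p zero)

/-- Two extensions are equivalent if their middle terms are isomorphic, compatibly with the
inflations and the deflations. -/
instance extensionSetoid (X Y : C) : Setoid (E.Extension X Y) where
  r A B := ∃ e : A.mid ≅ B.mid, A.i ≫ e.hom = B.i ∧ e.hom ≫ B.p = A.p
  iseqv :=
    { refl := fun A ↦ ⟨Iso.refl _, by simp, by simp⟩
      symm := by
        rintro A B ⟨e, h₁, h₂⟩
        exact ⟨e.symm, by simp [← h₁], by simp [← h₂]⟩
      trans := by
        rintro A B D ⟨e, h₁, h₂⟩ ⟨e', h₁', h₂'⟩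
        exact ⟨e ≪≫ e', by simp [reassoc_of% h₁, h₁'], by simp [h₂, h₂']⟩ }

/-- The Yoneda `Ext¹(X, Y)`: equivalence classes of conflations `0 ⟶ Y ⟶ Z ⟶ X ⟶ 0`. -/
def Ext1 (X Y : C) : Type (max u v) := Quotient (E.extensionSetoid X Y)

/-- `Ext¹(X, Y) = 0`, i.e. the split extension represents the only equivalence class. -/
def Ext1Vanishes (X Y : C) : Prop := Subsingleton (E.Ext1 X Y)

/-- The class `S^{⊥₁}` of all `Y` such that `Ext¹(X, Y) = 0` for all `X` in `S`. -/
def rightPerp (S : ObjectProperty C) : ObjectProperty C :=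
  fun Y ↦ ∀ X, S X → E.Ext1Vanishes X Y

/-- The class `^{⊥₁}S` of all `X` such that `Ext¹(X, Y) = 0` for all `Y` in `S`. -/
def leftPerp (S : ObjectProperty C) : ObjectProperty C :=
  fun X ↦ ∀ Y, S Y → E.Ext1Vanishes X Y

/-- `(F, T)` is a cotorsion pair. -/
structure IsCotorsionPair (F T : ObjectProperty C) : Prop where
  right_eq : E.rightPerp F = T
  left_eq : F = E.leftPerp T

/-- Existence of both approximation sequences `0 ⟶ Y ⟶ X ⟶ M ⟶ 0` and `0 ⟶ M ⟶ Y' ⟶ X' ⟶ 0`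
for every object `M`, with `X`, `X'` in `F` and `Y`, `Y'` in `T`. -/
structure HasApproximations (F T : ObjectProperty C) : Prop where
  left : ∀ M : C, ∃ (Y X : C) (i : Y ⟶ X) (p : X ⟶ M) (w : i ≫ p = 0),
    E.conflation (ShortComplex.mk i p w) ∧ F X ∧ T Y
  right : ∀ M : C, ∃ (Y' X' : C) (i : M ⟶ Y') (p : Y' ⟶ X') (w : i ≫ p = 0),
    E.conflation (ShortComplex.mk i p w) ∧ F X' ∧ T Y'

/-- The class `ΩF` of all kernels of deflations `P ⟶ X` with `P` projective and `X` in `F`. -/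
def syzygies (F : ObjectProperty C) : ObjectProperty C :=
  fun K ↦ ∃ (P X : C) (i : K ⟶ P) (p : P ⟶ X) (w : i ≫ p = 0),
    E.conflation (ShortComplex.mk i p w) ∧ E.IsProjective P ∧ F X

/-- `(F, T)` is a complete hereditary cotorsion pair; hereditary means that `ΩF ⊆ F`. -/
structure IsCompleteHereditaryCotorsionPair (F T : ObjectProperty C) : Prop where
  cotorsionPair : E.IsCotorsionPair F T
  complete : E.HasApproximations F T
  hereditary : E.syzygies F ≤ F

end ExactStructure

end Exact

/-! ### The stable category -/

namespace ExactStructure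

section Stable

variable {C : Type u} [Category.{v} C] [Preadditive C] (E : ExactStructure C)

/-- Two parallel morphisms are stably equal if their difference factors through a projective. -/
def stableRel : HomRel C :=
  fun X Y f g ↦ ∃ (P : C) (a : X ⟶ P) (b : P ⟶ Y), E.IsProjective P ∧ f - g = a ≫ b

/-- The stable category: the objects are those of `C`, the morphisms are the morphisms of `C`
modulo those which factor through a projective object. -/
abbrev StableCategory := CategoryTheory.Quotient E.stableRel

/-- The projection functor to the stable category. -/
abbrev toStable : C ⥤ E.StableCategory := CategoryTheory.Quotient.functor E.stableRel

variable {E}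

lemma IsProjective.exists_lift {P : C} (hP : E.IsProjective P) {Y Z : C} {p : Y ⟶ Z}
    (hp : E.Deflation p) (f : P ⟶ Z) : ∃ g : P ⟶ Y, g ≫ p = f := by
  obtain ⟨Y', f', p', sq, hp'⟩ := E.deflation_pullback p f hp
  obtain ⟨⟨s⟩⟩ := hP p' hp'
  exact ⟨s.section_ ≫ f', by rw [Category.assoc, sq.w, ← Category.assoc, s.id, Category.id_comp]⟩

lemma IsInjective.exists_extend {I : C} (hI : E.IsInjective I) {X Y : C} {i : X ⟶ Y}
    (hi : E.Inflation i) (f : X ⟶ I) : ∃ g : Y ⟶ I, i ≫ g = f := by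
  obtain ⟨Y', f', i', sq, hi'⟩ := E.inflation_pushout i f hi
  obtain ⟨⟨s⟩⟩ := hI i' hi'
  exact ⟨f' ≫ s.retraction, by
    rw [← Category.assoc, sq.w, Category.assoc, s.id, Category.comp_id]⟩

/-! ### Chosen cosyzygies -/

namespace IsFrobenius

variable (h : E.IsFrobenius)

/-- The injective object in the chosen conflation `0 ⟶ X ⟶ I ⟶ Ω⁻¹X ⟶ 0`. -/
noncomputable def hull (X : C) : C := (h.enough_injectives X).choose

/-- The inflation in the chosen conflation `0 ⟶ X ⟶ I ⟶ Ω⁻¹X ⟶ 0`. -/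
noncomputable def hullι (X : C) : X ⟶ h.hull X := (h.enough_injectives X).choose_spec.choose

lemma isInjective_hull (X : C) : E.IsInjective (h.hull X) :=
  (h.enough_injectives X).choose_spec.choose_spec.1

lemma inflation_hullι (X : C) : E.Inflation (h.hullι X) :=
  (h.enough_injectives X).choose_spec.choose_spec.2

/-- The object `Ω⁻¹X` in the chosen conflation `0 ⟶ X ⟶ I ⟶ Ω⁻¹X ⟶ 0`. -/
noncomputable def cosyzygy (X : C) : C := (h.inflation_hullι X).choose

/-- The deflation in the chosen conflation `0 ⟶ X ⟶ I ⟶ Ω⁻¹X ⟶ 0`. -/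
noncomputable def hullπ (X : C) : h.hull X ⟶ h.cosyzygy X :=
  (h.inflation_hullι X).choose_spec.choose

lemma hull_zero (X : C) : h.hullι X ≫ h.hullπ X = 0 :=
  (h.inflation_hullι X).choose_spec.choose_spec.choose

lemma conflation_hull (X : C) : E.conflation (ShortComplex.mk _ _ (h.hull_zero X)) :=
  (h.inflation_hullι X).choose_spec.choose_spec.choose_spec

lemma exists_desc {X Z : C} (f : h.hull X ⟶ Z) (w : h.hullι X ≫ f = 0) :
    ∃ g : h.cosyzygy X ⟶ Z, h.hullπ X ≫ g = f := by
  obtain ⟨hc⟩ := E.isCokernel (h.conflation_hull X)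
  exact ⟨hc.desc (CokernelCofork.ofπ f w), hc.fac _ WalkingParallelPair.one⟩

lemma epi_hullπ (X : C) : Epi (h.hullπ X) := by
  obtain ⟨hc⟩ := E.isCokernel (h.conflation_hull X)
  exact ⟨fun f g e ↦ Cofork.IsColimit.hom_ext hc e⟩

lemma exists_cosyzygyMap {X Y : C} (f : X ⟶ Y) :
    ∃ (g : h.cosyzygy X ⟶ h.cosyzygy Y) (a : h.hull X ⟶ h.hull Y),
      h.hullι X ≫ a = f ≫ h.hullι Y ∧ h.hullπ X ≫ g = a ≫ h.hullπ Y := by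
  obtain ⟨a, ha⟩ := (h.isInjective_hull Y).exists_extend (h.inflation_hullι X) (f ≫ h.hullι Y)
  obtain ⟨g, hg⟩ := h.exists_desc (a ≫ h.hullπ Y) (by
    rw [← Category.assoc, ha, Category.assoc, h.hull_zero, comp_zero])
  exact ⟨g, a, ha, hg⟩

/-- A morphism `Ω⁻¹X ⟶ Ω⁻¹Y` induced by `f : X ⟶ Y` through a morphism of the chosen
conflations; it is unique in the stable category. -/
noncomputable def cosyzygyMap {X Y : C} (f : X ⟶ Y) : h.cosyzygy X ⟶ h.cosyzygy Y :=
  (h.exists_cosyzygyMap f).choose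

lemma stableRel_cosyzygy {X Y : C} {f f' : X ⟶ Y} (hf : E.stableRel f f')
    {g g' : h.cosyzygy X ⟶ h.cosyzygy Y} {a a' : h.hull X ⟶ h.hull Y}
    (ha : h.hullι X ≫ a = f ≫ h.hullι Y) (hg : h.hullπ X ≫ g = a ≫ h.hullπ Y)
    (ha' : h.hullι X ≫ a' = f' ≫ h.hullι Y) (hg' : h.hullπ X ≫ g' = a' ≫ h.hullπ Y) :
    E.stableRel g g' := by
  obtain ⟨P, u, t, hP, e⟩ := hf
  rw [← h.injective_eq_projective] at hP
  obtain ⟨w, hw⟩ := hP.exists_extend (h.inflation_hullι X) u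
  obtain ⟨s, hs⟩ := h.exists_desc (a - a' - w ≫ t ≫ h.hullι Y) (by
    rw [Preadditive.comp_sub, Preadditive.comp_sub, ha, ha', ← Category.assoc, hw,
      ← Preadditive.sub_comp, e, Category.assoc, sub_self])
  refine ⟨h.hull Y, s, h.hullπ Y, h.injective_eq_projective ▸ h.isInjective_hull Y, ?_⟩
  have := h.epi_hullπ X
  rw [← cancel_epi (h.hullπ X), ← Category.assoc, hs, Preadditive.comp_sub, hg, hg',
    Preadditive.sub_comp, Preadditive.sub_comp, Category.assoc, Category.assoc, h.hull_zero]
  simp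

end IsFrobenius

lemma IsProjective.biprod [HasBinaryBiproducts C] {P Q : C} (hP : E.IsProjective P)
    (hQ : E.IsProjective Q) : E.IsProjective (P ⊞ Q) := by
  intro Y p hp
  obtain ⟨a, ha⟩ := hP.exists_lift hp biprod.inl
  obtain ⟨b, hb⟩ := hQ.exists_lift hp biprod.inr
  exact ⟨⟨⟨biprod.desc a b, by ext <;> simp [ha, hb]⟩⟩⟩

lemma isProjective_zero [HasZeroObject C] : E.IsProjective (0 : C) :=
  fun _ _ _ ↦ ⟨⟨⟨0, (isZero_zero C).eq_of_tgt _ _⟩⟩⟩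

variable [HasBinaryBiproducts C]

lemma stableRel_add {X Y : C} (f₁ f₂ g₁ g₂ : X ⟶ Y) (h : E.stableRel f₁ f₂)
    (h' : E.stableRel g₁ g₂) : E.stableRel (f₁ + g₁) (f₂ + g₂) := by
  obtain ⟨P, a, b, hP, e⟩ := h
  obtain ⟨Q, c, d, hQ, e'⟩ := h'
  exact ⟨P ⊞ Q, biprod.lift a c, biprod.desc b d, hP.biprod hQ, by
    rw [biprod.lift_desc, ← e, ← e']; abel⟩

variable [HasZeroObject C]

instance : Congruence E.stableRel where
  equivalence :=
    { refl := fun f ↦ ⟨0, 0, 0, isProjective_zero, by simp⟩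
      symm := by
        rintro f g ⟨P, a, b, hP, e⟩
        exact ⟨P, -a, b, hP, by rw [Preadditive.neg_comp, ← e]; abel⟩
      trans := by
        rintro f g h ⟨P, a, b, hP, e⟩ ⟨Q, c, d, hQ, e'⟩
        exact ⟨P ⊞ Q, biprod.lift a c, biprod.desc b d, hP.biprod hQ, by
          rw [biprod.lift_desc, ← e, ← e']; abel⟩ }
  comp_left := by
    rintro X Y Z f g g' ⟨P, a, b, hP, e⟩
    exact ⟨P, f ≫ a, b, hP, by rw [← Preadditive.comp_sub, e, Category.assoc]⟩
  comp_right := by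
    rintro X Y Z f f' g ⟨P, a, b, hP, e⟩
    exact ⟨P, a, b ≫ g, hP, by rw [← Preadditive.sub_comp, e, Category.assoc]⟩

/-- The additive structure on the stable category. -/
instance : Preadditive E.StableCategory :=
  CategoryTheory.Quotient.preadditive E.stableRel (fun _ _ ↦ stableRel_add)

/-! ### The suspension functor -/

namespace IsFrobenius

variable (h : E.IsFrobenius)

/-- The functor `C ⥤ StableCategory` sending `X` to `Ω⁻¹X`. -/
noncomputable def preSuspension : C ⥤ E.StableCategory where
  obj X := E.toStable.obj (h.cosyzygy X)
  map f := E.toStable.map (h.cosyzygyMap f)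
  map_id X := by
    rw [← E.toStable.map_id]
    obtain ⟨a, ha, hg⟩ := (h.exists_cosyzygyMap (𝟙 X)).choose_spec
    exact (CategoryTheory.Quotient.functor_map_eq_iff _ _ _).2
      (h.stableRel_cosyzygy (Congruence.equivalence.refl (𝟙 X)) ha hg (a' := 𝟙 _)
        (by simp) (by simp))
  map_comp {X Y Z} f f' := by
    rw [← E.toStable.map_comp]
    obtain ⟨a, ha, hg⟩ := (h.exists_cosyzygyMap f).choose_spec
    obtain ⟨a', ha', hg'⟩ := (h.exists_cosyzygyMap f').choose_spec
    obtain ⟨b, hb, hk⟩ := (h.exists_cosyzygyMap (f ≫ f')).choose_spec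
    refine (CategoryTheory.Quotient.functor_map_eq_iff _ _ _).2
      (h.stableRel_cosyzygy (Congruence.equivalence.refl (f ≫ f')) hb hk (a' := a ≫ a') ?_ ?_)
    · rw [← Category.assoc, ha, Category.assoc, ha', Category.assoc]
    · erw [← Category.assoc, hg, Category.assoc, hg', Category.assoc]

/-- The suspension functor `[1] = Ω⁻¹` of the stable category. -/
noncomputable def suspension : E.StableCategory ⥤ E.StableCategory :=
  CategoryTheory.Quotient.lift E.stableRel h.preSuspension (by
    intro X Y f f' hf
    obtain ⟨a, ha, hg⟩ := (h.exists_cosyzygyMap f).choose_spec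
    obtain ⟨a', ha', hg'⟩ := (h.exists_cosyzygyMap f').choose_spec
    exact (CategoryTheory.Quotient.functor_map_eq_iff _ _ _).2
      (h.stableRel_cosyzygy hf ha hg ha' hg'))

end IsFrobenius

end Stable

end ExactStructure

/-! ### Triangles and weight structures -/

section Weight

variable {D : Type u} [Category.{v} D]

/-- A triangle `A ⟶ B ⟶ K ⟶ S A` with respect to an endofunctor `S`. -/
structure SuspensionTriangle (S : D ⥤ D) where
  /-- the first object -/
  {A : D}
  /-- the second object -/
  {B : D}
  /-- the third object -/
  {K : D}
  /-- the first morphism -/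
  f : A ⟶ B
  /-- the second morphism -/
  g : B ⟶ K
  /-- the third morphism -/
  k : K ⟶ S.obj A

/-- Two triangles are isomorphic. -/
def SuspensionTriangle.IsIsomorphic {S : D ⥤ D} (Δ Δ' : SuspensionTriangle S) : Prop :=
  ∃ (a : Δ.A ≅ Δ'.A) (b : Δ.B ≅ Δ'.B) (c : Δ.K ≅ Δ'.K),
    Δ.f ≫ b.hom = a.hom ≫ Δ'.f ∧ Δ.g ≫ c.hom = b.hom ≫ Δ'.g ∧ Δ.k ≫ S.map a.hom = c.hom ≫ Δ'.k

/-- `(X, Y)` is a Hom-orthogonal pair. -/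
structure IsHomOrthogonalPair [Preadditive D] (X Y : ObjectProperty D) : Prop where
  right_eq : X.rightOrthogonal = Y
  left_eq : X = Y.leftOrthogonal

/-- Weight structures `(X, Y)` on a triangulated category with underlying additive category `D`,
suspension functor `S` and class of distinguished triangles `dist`. Here `X.map S` is the class
`X[1]`, i.e. the essential image of `X` under `S`; full subcategories are taken to be closed under
isomorphism, which for `Y` follows from the orthogonality. -/
structure IsWeightStructure [Preadditive D] (S : D ⥤ D) (dist : SuspensionTriangle S → Prop)
    (X Y : ObjectProperty D) : Prop where
  isClosedUnderIsomorphisms : X.IsClosedUnderIsomorphisms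
  orthogonal : IsHomOrthogonalPair Y (X.map S)
  shift_le : X.map S ≤ X
  exists_triangle : ∀ M : D, ∃ (A B : D) (f : M ⟶ A) (g : A ⟶ B) (k : B ⟶ S.obj M),
    dist (SuspensionTriangle.mk f g k) ∧ X A ∧ Y B

end Weight

namespace ExactStructure

variable {C : Type u} [Category.{v} C] [Preadditive C] [HasZeroObject C] [HasBinaryBiproducts C]
  {E : ExactStructure C}

/-- The standard triangle `X ⟶ Y ⟶ K ⟶ Ω⁻¹X` in the stable category given by morphisms of `C`. -/
noncomputable def IsFrobenius.stableTriangle (h : E.IsFrobenius) {X Y K : C} (f : X ⟶ Y) (g : Y ⟶ K)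
    (k : K ⟶ h.cosyzygy X) : SuspensionTriangle h.suspension where
  A := E.toStable.obj X
  B := E.toStable.obj Y
  K := E.toStable.obj K
  f := E.toStable.map f
  g := E.toStable.map g
  k := E.toStable.map k

/-- The distinguished triangles of the stable category: those isomorphic to a standard triangle
`X ⟶ Y ⟶ K ⟶ Ω⁻¹X`, where `f : X ⟶ Y` is any morphism of `C`, `K` is the pushout of `f` and
of the chosen inflation `X ⟶ I` with `I` injective, and `K ⟶ Ω⁻¹X` is the morphism which is zero
on `Y` and the chosen deflation `I ⟶ Ω⁻¹X` on `I`. -/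
def IsFrobenius.Distinguished (h : E.IsFrobenius) (Δ : SuspensionTriangle h.suspension) : Prop :=
  ∃ (X Y K : C) (f : X ⟶ Y) (g : Y ⟶ K) (j : h.hull X ⟶ K) (k : K ⟶ h.cosyzygy X),
    IsPushout f (h.hullι X) g j ∧ g ≫ k = 0 ∧ j ≫ k = h.hullπ X ∧
      Δ.IsIsomorphic (h.stableTriangle f g k)

/-- Weight structures `(X, Y)` on the stable category of a Frobenius exact category. -/
def IsFrobenius.IsStableWeightStructure (h : E.IsFrobenius)
    (X Y : ObjectProperty E.StableCategory) : Prop :=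
  IsWeightStructure h.suspension h.Distinguished X Y

/-- The class `F̲`, as a full subcategory of the stable category: the essential image of `F`. -/
abbrev stableImage (E : ExactStructure C) (F : ObjectProperty C) :
    ObjectProperty E.StableCategory :=
  F.map E.toStable

/-- The class `F̲`, viewed as a full subcategory of `C`: the objects of `C` which are isomorphic
in the stable category to an object of `F`. -/
abbrev stableClosure (E : ExactStructure C) (F : ObjectProperty C) : ObjectProperty C :=
  (E.stableImage F).inverseImage E.toStable

end ExactStructure

/-! Everything rests on the identification of `Ext¹(X, Y) = 0` with the vanishing of all stable
morphisms `X ⟶ Y[1]` (`ext1Vanishes_iff`). Cotorsion pairs are therefore invariant under stable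
isomorphism and amount to pairs `(P, Q)` in the stable category with `P` and `Q[1]` Hom-orthogonal
(`isCotorsionPair_iff`). Since the suspension is fully faithful and essentially surjective,
morphisms `ΩX ⟶ Y[1]` are morphisms `X ⟶ Y[2]`, so `ΩP ⊆ P` says the same as `Q[1] ⊆ Q`
(`syzygies_le_iff`).

For completeness, a conflation `M ⟶ Y ⟶ X` yields a standard triangle by pushing out along the hull
of `M` (`exists_triangle`). Conversely, a standard triangle on `f : X ⟶ Y` comes from a conflation
`X ⟶ Y ⊞ I ⟶ K`, and `exists_conflation_of_stableIso` makes it start at the prescribed object `M`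
rather than at a stably isomorphic one. Triangles give only the approximations `M ⟶ Y' ⟶ X'`; those
ending in `M` follow by a pushout argument of Salce type (`hasApproximations_of_right`).

The bijection is then formal, because both halves of a cotorsion pair equal their stable closures.
-/

namespace ExactStructure

section Conflations

variable {C : Type u} [Category.{v} C] [Preadditive C] {E : ExactStructure C}

/-! ### Conflations -/

section

variable {X Y Z : C} {i : X ⟶ Y} {p : Y ⟶ Z} {w : i ≫ p = 0}

lemma epi_of_conflation (hS : E.conflation (ShortComplex.mk i p w)) : Epi p := by
  obtain ⟨hc⟩ := E.isCokernel hS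
  exact ⟨fun f g e ↦ Cofork.IsColimit.hom_ext hc e⟩

lemma mono_of_conflation (hS : E.conflation (ShortComplex.mk i p w)) : Mono i := by
  obtain ⟨hc⟩ := E.isKernel hS
  exact ⟨fun f g e ↦ Fork.IsLimit.hom_ext hc e⟩

lemma exists_desc_of_conflation (hS : E.conflation (ShortComplex.mk i p w)) {A : C} (k : Y ⟶ A)
    (hk : i ≫ k = 0) : ∃ l : Z ⟶ A, p ≫ l = k := by
  obtain ⟨hc⟩ := E.isCokernel hS
  exact ⟨hc.desc (CokernelCofork.ofπ k hk), hc.fac _ WalkingParallelPair.one⟩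

lemma exists_lift_of_conflation (hS : E.conflation (ShortComplex.mk i p w)) {A : C} (k : A ⟶ Y)
    (hk : k ≫ p = 0) : ∃ l : A ⟶ X, l ≫ i = k := by
  obtain ⟨hc⟩ := E.isKernel hS
  exact ⟨hc.lift (KernelFork.ofι k hk), hc.fac _ WalkingParallelPair.zero⟩

lemma inflation_of_conflation (hS : E.conflation (ShortComplex.mk i p w)) : E.Inflation i :=
  ⟨_, _, _, hS⟩

lemma deflation_of_conflation (hS : E.conflation (ShortComplex.mk i p w)) : E.Deflation p :=
  ⟨_, _, _, hS⟩

/-- An inflation and its cokernel form a conflation. -/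
lemma conflation_of_inflation (hi : E.Inflation i) (hp : Epi p)
    (H : ∀ ⦃A : C⦄ (k : Y ⟶ A), i ≫ k = 0 → ∃ l : Z ⟶ A, p ≫ l = k) :
    E.conflation (ShortComplex.mk i p w) := by
  obtain ⟨Z', p', w', hS⟩ := hi
  obtain ⟨a, ha⟩ := exists_desc_of_conflation hS p w
  obtain ⟨b, hb⟩ := H p' w'
  have := epi_of_conflation hS
  have hab : a ≫ b = 𝟙 _ := by rw [← cancel_epi p', reassoc_of% ha, hb, Category.comp_id]
  have hba : b ≫ a = 𝟙 _ := by rw [← cancel_epi p, reassoc_of% hb, ha, Category.comp_id]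
  exact E.conflation_of_iso (S := ShortComplex.mk i p' w')
    (ShortComplex.isoMk (Iso.refl _) (Iso.refl _) ⟨a, b, hab, hba⟩ (by simp) (by simp [ha])) hS

/-- A deflation and its kernel form a conflation. -/
lemma conflation_of_deflation (hp : E.Deflation p) (hi : Mono i)
    (H : ∀ ⦃A : C⦄ (k : A ⟶ Y), k ≫ p = 0 → ∃ l : A ⟶ X, l ≫ i = k) :
    E.conflation (ShortComplex.mk i p w) := by
  obtain ⟨X', i', w', hS⟩ := hp
  obtain ⟨a, ha⟩ := exists_lift_of_conflation hS i w
  obtain ⟨b, hb⟩ := H i' w'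
  have := mono_of_conflation hS
  have hab : a ≫ b = 𝟙 _ := by rw [← cancel_mono i, Category.assoc, hb, ha, Category.id_comp]
  have hba : b ≫ a = 𝟙 _ := by rw [← cancel_mono i', Category.assoc, ha, hb, Category.id_comp]
  exact E.conflation_of_iso (S := ShortComplex.mk i' p w')
    (ShortComplex.isoMk ⟨b, a, hba, hab⟩ (Iso.refl _) (Iso.refl _) (by simp [hb]) (by simp)) hS

lemma inflation_comp_iso {Y' : C} (hi : E.Inflation i) (e : Y ≅ Y') : E.Inflation (i ≫ e.hom) := by
  obtain ⟨Z, p, w, hS⟩ := hi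
  exact ⟨Z, e.inv ≫ p, by simp [w], E.conflation_of_iso (S := ShortComplex.mk i p w)
    (ShortComplex.isoMk (Iso.refl _) e (Iso.refl _) (by simp) (by simp)) hS⟩

lemma iso_comp_deflation {Y' : C} (hp : E.Deflation p) (e : Y' ≅ Y) : E.Deflation (e.hom ≫ p) := by
  obtain ⟨X, i, w, hS⟩ := hp
  exact ⟨X, i ≫ e.inv, by simp [w], E.conflation_of_iso (S := ShortComplex.mk i p w)
    (ShortComplex.isoMk (Iso.refl _) e.symm (Iso.refl _) (by simp) (by simp)) hS⟩

lemma inflation_of_isPushout {X' Y' : C} {f : X ⟶ X'} {f' : Y ⟶ Y'} {i' : X' ⟶ Y'}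
    (hi : E.Inflation i) (sq : IsPushout i f f' i') : E.Inflation i' := by
  obtain ⟨Y₁, f₁, i₁, sq₁, hi₁⟩ := E.inflation_pushout i f hi
  simpa using inflation_comp_iso hi₁ (sq₁.isoIsPushout _ _ sq)

lemma deflation_of_isPullback {Y' Z' : C} {f : Z' ⟶ Z} {f' : Y' ⟶ Y} {p' : Y' ⟶ Z'}
    (hp : E.Deflation p) (sq : IsPullback f' p' p f) : E.Deflation p' := by
  obtain ⟨Y₁, f₁, p₁, sq₁, hp₁⟩ := E.deflation_pullback p f hp
  simpa using iso_comp_deflation hp₁ (sq.isoIsPullback _ _ sq₁)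

/-- The pushout of a conflation along a morphism out of its first term. -/
lemma exists_conflation_of_isPushout (hS : E.conflation (ShortComplex.mk i p w)) {X' Y' : C}
    {f : X ⟶ X'} {f' : Y ⟶ Y'} {i' : X' ⟶ Y'} (sq : IsPushout i f f' i') :
    ∃ (p' : Y' ⟶ Z) (w' : i' ≫ p' = 0), f' ≫ p' = p ∧
      E.conflation (ShortComplex.mk i' p' w') := by
  have hp := epi_of_conflation hS
  have h₁ : f' ≫ sq.desc p 0 (by simp [w]) = p := sq.inl_desc _ _ _
  refine ⟨sq.desc p 0 (by simp [w]), sq.inr_desc _ _ _, h₁,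
    conflation_of_inflation (inflation_of_isPushout (inflation_of_conflation hS) sq)
    (epi_of_epi_fac h₁) fun A k hk ↦ ?_⟩
  obtain ⟨l, hl⟩ := exists_desc_of_conflation hS (f' ≫ k) (by
    rw [← Category.assoc, sq.w, Category.assoc, hk, comp_zero])
  exact ⟨l, sq.hom_ext (by rw [reassoc_of% h₁, hl]) (by simp [hk])⟩

/-- The pullback of a conflation along a morphism into its last term. -/
lemma exists_conflation_of_isPullback (hS : E.conflation (ShortComplex.mk i p w)) {Y' Z' : C}
    {f : Z' ⟶ Z} {f' : Y' ⟶ Y} {p' : Y' ⟶ Z'} (sq : IsPullback f' p' p f) :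
    ∃ (i' : X ⟶ Y') (w' : i' ≫ p' = 0), i' ≫ f' = i ∧
      E.conflation (ShortComplex.mk i' p' w') := by
  have hi := mono_of_conflation hS
  have h₁ : sq.lift i 0 (by simp [w]) ≫ f' = i := sq.lift_fst _ _ _
  refine ⟨sq.lift i 0 (by simp [w]), sq.lift_snd _ _ _, h₁,
    conflation_of_deflation (deflation_of_isPullback (deflation_of_conflation hS) sq)
    (mono_of_mono_fac h₁) fun A k hk ↦ ?_⟩
  obtain ⟨l, hl⟩ := exists_lift_of_conflation hS (k ≫ f') (by
    rw [Category.assoc, sq.w, reassoc_of% hk, zero_comp])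
  exact ⟨l, sq.hom_ext (by rw [Category.assoc, h₁, hl]) (by simp [hk])⟩

/-- The composition of two inflations, where the cokernel of the composite is the pushout of the
second inflation along the cokernel of the first. -/
lemma conflation_comp_of_isPushout {V Q : C} {j : Y ⟶ V} {q : Z ⟶ Q} {q' : V ⟶ Q}
    (hS : E.conflation (ShortComplex.mk i p w)) (hj : E.Inflation j) (sq : IsPushout j p q' q) :
    E.conflation (ShortComplex.mk (i ≫ j) q' (by rw [Category.assoc, sq.w, reassoc_of% w,
      zero_comp])) := by
  have hp := epi_of_conflation hS
  refine conflation_of_inflation (E.inflation_comp _ _ (inflation_of_conflation hS) hj)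
    ⟨fun a b e ↦ sq.hom_ext e ?_⟩ fun A k hk ↦ ?_
  · rw [← cancel_epi p, ← sq.w_assoc, e, sq.w_assoc]
  · obtain ⟨l, hl⟩ := exists_desc_of_conflation hS (j ≫ k) (by rw [← Category.assoc, hk])
    exact ⟨sq.desc k l hl.symm, sq.inl_desc _ _ _⟩

end

/-! ### Split conflations and inflations into biproducts. -/

section Biproducts

variable [HasZeroObject C]

lemma conflation_zero_id (X : C) :
    E.conflation (ShortComplex.mk (0 : 0 ⟶ X) (𝟙 X) zero_comp) :=
  conflation_of_deflation (E.deflation_id X) ⟨fun _ _ _ ↦ (isZero_zero C).eq_of_tgt _ _⟩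
    fun A k hk ↦ ⟨0, by simpa using hk.symm⟩

variable [HasBinaryBiproducts C]

lemma isPushout_inr_map (Y : C) {X Z : C} (i : X ⟶ Z) :
    IsPushout i (biprod.inr : X ⟶ Y ⊞ X) (biprod.inr : Z ⟶ Y ⊞ Z) (biprod.map (𝟙 Y) i) :=
  IsPushout.of_left (by simpa using (IsPushout.of_has_biproduct Y Z).flip) (by simp)
    (IsPushout.of_has_biproduct Y X).flip

lemma inflation_inr (X Y : C) : E.Inflation (biprod.inr : Y ⟶ X ⊞ Y) :=
  inflation_of_isPushout (inflation_of_conflation (conflation_zero_id X))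
    (IsPushout.of_has_biproduct X Y)

lemma conflation_inr_fst (X Y : C) :
    E.conflation (ShortComplex.mk (biprod.inr : Y ⟶ X ⊞ Y) biprod.fst biprod.inr_fst) :=
  conflation_of_inflation (inflation_inr X Y) inferInstance
    fun A k hk ↦ ⟨biprod.inl ≫ k, by ext <;> simp [hk]⟩

/-- The map is a composite of `inr : X ⟶ Y ⊞ X`, the shear automorphism that adds `f` to the first
coordinate, and `𝟙 ⊞ i`, which is a pushout of `i`. This replaces an arbitrary morphism by an
inflation at the cost of an injective summand. -/
lemma inflation_lift {X Y I : C} (f : X ⟶ Y) {i : X ⟶ I} (hi : E.Inflation i) :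
    E.Inflation (biprod.lift f i) := by
  let e : Y ⊞ X ≅ Y ⊞ X :=
    { hom := biprod.lift (biprod.fst + biprod.snd ≫ f) biprod.snd
      inv := biprod.lift (biprod.fst - biprod.snd ≫ f) biprod.snd
      hom_inv_id := by ext <;> simp
      inv_hom_id := by ext <;> simp }
  have h₁ := E.inflation_comp _ _ (inflation_comp_iso (inflation_inr Y X) e)
    (inflation_of_isPushout hi (isPushout_inr_map Y i))
  have h₂ : (biprod.inr ≫ e.hom) ≫ biprod.map (𝟙 Y) i = biprod.lift f i := by
    ext <;> simp [e]
  rwa [h₂] at h₁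

/-- The pushout of a morphism and an inflation, as a conflation. -/
lemma conflation_lift_of_isPushout {X Y I K : C} {f : X ⟶ Y} {i : X ⟶ I} {g : Y ⟶ K} {j : I ⟶ K}
    (hi : E.Inflation i) (sq : IsPushout f i g j) :
    E.conflation (ShortComplex.mk (biprod.lift f i) (biprod.desc g (-j)) (by simp [sq.w])) := by
  refine conflation_of_inflation (inflation_lift f hi) ⟨fun a b e ↦ sq.hom_ext ?_ ?_⟩
    fun A k hk ↦ ⟨sq.desc (biprod.inl ≫ k) (-biprod.inr ≫ k) ?_, ?_⟩
  · simpa using biprod.inl ≫= e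
  · simpa using biprod.inr ≫= e
  · rw [biprod.lift_eq, Preadditive.add_comp, Category.assoc, Category.assoc] at hk
    simpa using eq_neg_of_add_eq_zero_left hk
  · ext <;> simp

end Biproducts

end Conflations

end ExactStructure

namespace ExactStructure

/-! ### Stable isomorphisms and conflations. -/

section StableIsomorphisms

variable {C : Type u} [Category.{v} C] [Preadditive C] {E : ExactStructure C}

lemma IsProjective.of_retract {P Q : C} (hQ : E.IsProjective Q) (a : P ⟶ Q) (b : Q ⟶ P)
    (hab : a ≫ b = 𝟙 P) : E.IsProjective P := by
  intro Y p hp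
  obtain ⟨c, hc⟩ := hQ.exists_lift hp b
  exact ⟨⟨⟨a ≫ c, by rw [Category.assoc, hc, hab]⟩⟩⟩

lemma IsFrobenius.isInjective (h : E.IsFrobenius) {P : C} (hP : E.IsProjective P) :
    E.IsInjective P := h.injective_eq_projective ▸ hP

lemma IsFrobenius.isProjective (h : E.IsFrobenius) {P : C} (hP : E.IsInjective P) :
    E.IsProjective P := h.injective_eq_projective ▸ hP

variable [HasZeroObject C] [HasBinaryBiproducts C]

lemma toStable_map_eq_iff {X Y : C} (f g : X ⟶ Y) :
    E.toStable.map f = E.toStable.map g ↔ E.stableRel f g :=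
  CategoryTheory.Quotient.functor_map_eq_iff _ _ _

lemma toStable_map_eq_zero_iff {X Y : C} (f : X ⟶ Y) :
    E.toStable.map f = 0 ↔ ∃ (P : C) (a : X ⟶ P) (b : P ⟶ Y), E.IsProjective P ∧ f = a ≫ b :=
  (toStable_map_eq_iff f 0).trans (by simp [stableRel])

lemma nonempty_stableIso {X Y : C} (a : X ⟶ Y) (b : Y ⟶ X) (hab : E.stableRel (𝟙 X) (a ≫ b))
    (hba : E.stableRel (𝟙 Y) (b ≫ a)) : Nonempty (E.toStable.obj X ≅ E.toStable.obj Y) :=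
  ⟨E.toStable.map a, E.toStable.map b,
    by rw [← E.toStable.map_comp, ← E.toStable.map_id, eq_comm, toStable_map_eq_iff]; exact hab,
    by rw [← E.toStable.map_comp, ← E.toStable.map_id, eq_comm, toStable_map_eq_iff]; exact hba⟩

lemma nonempty_stableIso_biprod_of_isProjective {P : C} (hP : E.IsProjective P) (X : C) :
    Nonempty (E.toStable.obj (P ⊞ X) ≅ E.toStable.obj X) :=
  nonempty_stableIso biprod.snd biprod.inr
    ⟨P, biprod.fst, biprod.inl, hP, by ext <;> simp⟩
    (by rw [biprod.inr_snd]; exact Congruence.equivalence.refl _)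

/-- The pushout of an inflation along a morphism to an injective and projective object is stably
isomorphic to the cokernel of the inflation. -/
lemma nonempty_stableIso_of_isPushout {X Y Z I K : C} {i : X ⟶ Y} {p : Y ⟶ Z} {w : i ≫ p = 0}
    (hS : E.conflation (ShortComplex.mk i p w)) {t : X ⟶ I} {g : Y ⟶ K} {j : I ⟶ K}
    (sq : IsPushout i t g j) (hI : E.IsInjective I) (hI' : E.IsProjective I) :
    Nonempty (E.toStable.obj K ≅ E.toStable.obj Z) := by
  -- As `t` extends over `i`, the pushed-out conflation `I ⟶ K ⟶ Z` splits: `r` below retracts `j`,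
  -- `s` is a section of `q`, and `𝟙 K - q ≫ s = r ≫ j` factors through `I`.
  obtain ⟨e, he⟩ := hI.exists_extend (inflation_of_conflation hS) t
  obtain ⟨s, hs⟩ := exists_desc_of_conflation hS (g - e ≫ j) (by
    rw [Preadditive.comp_sub, reassoc_of% he, sq.w, sub_self])
  have hp := epi_of_conflation hS
  obtain ⟨q, hgq, hjq⟩ := sq.exists_desc p 0 (by simp [w])
  obtain ⟨r, hgr, hjr⟩ := sq.exists_desc e (𝟙 _) (by simp [he])
  refine nonempty_stableIso q s ⟨I, r, j, hI', sq.hom_ext ?_ ?_⟩ ?_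
  · rw [Preadditive.comp_sub, reassoc_of% hgq, hs, reassoc_of% hgr]
    simp
  · rw [Preadditive.comp_sub, reassoc_of% hjq, reassoc_of% hjr]
    simp
  · have : s ≫ q = 𝟙 _ := by
      rw [← cancel_epi p, reassoc_of% hs, Preadditive.sub_comp, Category.assoc, hgq, hjq]
      simp
    rw [this]
    exact Congruence.equivalence.refl _

/-- The cokernel of an inflation which is a stable isomorphism is projective. -/
lemma isProjective_of_conflation_of_isIso (h : E.IsFrobenius) {X Y Z : C} {i : X ⟶ Y} {p : Y ⟶ Z}
    {w : i ≫ p = 0} (hS : E.conflation (ShortComplex.mk i p w)) [IsIso (E.toStable.map i)] :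
    E.IsProjective Z := by
  obtain ⟨t, ht⟩ := E.toStable.map_surjective (inv (E.toStable.map i))
  have h₁ : E.stableRel (𝟙 X) (i ≫ t) := by
    rw [← toStable_map_eq_iff, E.toStable.map_comp, ht, IsIso.hom_inv_id, E.toStable.map_id]
  obtain ⟨Q, a, b, hQ, e⟩ := h₁
  -- The stable inverse `t` is corrected to a genuine retraction of `i`: the error `𝟙 - i ≫ t`
  -- passes through `Q`, which is injective, so it extends along `i`.
  obtain ⟨a', ha'⟩ := (h.isInjective hQ).exists_extend (inflation_of_conflation hS) a
  have hr : i ≫ (t + a' ≫ b) = 𝟙 X := by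
    rw [Preadditive.comp_add, reassoc_of% ha', ← e]; abel
  generalize t + a' ≫ b = r at hr
  have h₂ : E.stableRel (𝟙 Y) (r ≫ i) := by
    rw [← toStable_map_eq_iff, E.toStable.map_comp, E.toStable.map_id,
      ← cancel_epi (E.toStable.map i), ← Category.assoc, ← E.toStable.map_comp, hr]
    simp
  obtain ⟨Q', c, d, hQ', e'⟩ := h₂
  obtain ⟨s, hs⟩ := exists_desc_of_conflation hS (𝟙 Y - r ≫ i) (by
    rw [Preadditive.comp_sub, reassoc_of% hr, Category.comp_id, sub_self])
  have hp := epi_of_conflation hS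
  have hsp : s ≫ p = 𝟙 Z := by
    rw [← cancel_epi p, reassoc_of% hs, Preadditive.sub_comp, Category.assoc, w]; simp
  -- The idempotent `𝟙 Y - r ≫ i` has image `Z` and factors through the projective `Q'`, so `Z` is a
  -- retract of `Q'`.
  refine hQ'.of_retract (s ≫ c) (d ≫ p) ?_
  rw [Category.assoc, ← Category.assoc c, ← e', Preadditive.sub_comp, Category.assoc r, w]
  simp [hsp]

/-- If `M` is stably isomorphic to `X`, a conflation starting in `X` can be replaced by a conflation
starting in `M` whose other terms are stably isomorphic to the original ones. -/
lemma exists_conflation_of_stableIso (h : E.IsFrobenius) {M X Y K : C} {i : X ⟶ Y} {p : Y ⟶ K}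
    {w : i ≫ p = 0} (hS : E.conflation (ShortComplex.mk i p w))
    (φ : E.toStable.obj M ≅ E.toStable.obj X) :
    ∃ (Y' K' : C) (i' : M ⟶ Y') (p' : Y' ⟶ K') (w' : i' ≫ p' = 0),
      E.conflation (ShortComplex.mk i' p' w') ∧
      Nonempty (E.toStable.obj Y' ≅ E.toStable.obj Y) ∧
      Nonempty (E.toStable.obj K' ≅ E.toStable.obj K) := by
  obtain ⟨f, hf⟩ := E.toStable.map_surjective φ.hom
  have hI := h.isProjective (h.isInjective_hull M)
  -- Adding the hull of `M` turns the representative `f` of `φ` into an inflation `M ⟶ I ⊞ X` that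
  -- is still a stable isomorphism, so its cokernel `P` is projective.
  have hj : E.Inflation (biprod.lift (h.hullι M) f) := by
    have hb : biprod.lift f (h.hullι M) ≫ (biprod.braiding X (h.hull M)).hom =
        biprod.lift (h.hullι M) f := by ext <;> simp
    exact hb ▸ inflation_comp_iso (inflation_lift f (h.inflation_hullι M)) _
  obtain ⟨P, q, wq, hq⟩ := hj
  have hiso : IsIso (E.toStable.map (biprod.lift (h.hullι M) f)) := by
    have h₁ : IsIso (E.toStable.map (biprod.snd : h.hull M ⊞ X ⟶ X)) := by
      refine ⟨E.toStable.map biprod.inr, ?_, ?_⟩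
      · rw [← E.toStable.map_comp, ← E.toStable.map_id, eq_comm, toStable_map_eq_iff]
        exact ⟨h.hull M, biprod.fst, biprod.inl, hI, by ext <;> simp⟩
      · rw [← E.toStable.map_comp, biprod.inr_snd, E.toStable.map_id]
    have h₂ : IsIso (E.toStable.map (biprod.lift (h.hullι M) f) ≫
        E.toStable.map (biprod.snd : h.hull M ⊞ X ⟶ X)) := by
      rw [← E.toStable.map_comp, biprod.lift_snd, hf]
      infer_instance
    exact IsIso.of_isIso_comp_right _ (E.toStable.map (biprod.snd : h.hull M ⊞ X ⟶ X))
  have hP := isProjective_of_conflation_of_isIso h hq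
  obtain ⟨p₁, w₁, -, h₁⟩ := exists_conflation_of_isPushout hS (isPushout_inr_map (h.hull M) i)
  -- The new conflation starts with `M ⟶ I ⊞ X ⟶ I ⊞ Y`. Its cokernel is a pushout along a map to
  -- `P`, hence stably still `K`.
  obtain ⟨K', a, b, sq, -⟩ := E.inflation_pushout _ q (inflation_of_conflation h₁)
  exact ⟨_, K', _, a, _, conflation_comp_of_isPushout hq (inflation_of_conflation h₁) sq,
    nonempty_stableIso_biprod_of_isProjective hI Y,
    nonempty_stableIso_of_isPushout h₁ sq (h.isInjective hP) hP⟩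

end StableIsomorphisms

/-! ### `Ext¹` and the suspension -/

section Ext

variable {C : Type u} [Category.{v} C] [Preadditive C] [HasZeroObject C] [HasBinaryBiproducts C]
  {E : ExactStructure C}

lemma ext1Vanishes_iff_exists_retraction (X Y : C) :
    E.Ext1Vanishes X Y ↔ ∀ A : E.Extension X Y, ∃ r : A.mid ⟶ Y, A.i ≫ r = 𝟙 Y := by
  let B : E.Extension X Y := ⟨X ⊞ Y, biprod.inr, biprod.fst, _, conflation_inr_fst X Y⟩
  constructor
  · intro H A
    have := H
    obtain ⟨e, he, -⟩ : A ≈ B := Quotient.exact (H.elim (Quotient.mk _ A) (Quotient.mk _ B))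
    exact ⟨e.hom ≫ biprod.snd, by rw [← Category.assoc, he]; exact biprod.inr_snd⟩
  · intro H
    have key : ∀ A : E.Extension X Y, A ≈ B := by
      intro A
      obtain ⟨r, hr⟩ := H A
      have := epi_of_conflation A.conflation
      obtain ⟨s, hs⟩ := exists_desc_of_conflation A.conflation (𝟙 _ - r ≫ A.i) (by
        rw [Preadditive.comp_sub, reassoc_of% hr, Category.comp_id, sub_self])
      have h₁ : s ≫ A.p = 𝟙 X := by
        rw [← cancel_epi A.p, reassoc_of% hs, Preadditive.sub_comp, Category.assoc, A.zero]; simp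
      have h₂ : s ≫ r = 0 := by
        rw [← cancel_epi A.p, reassoc_of% hs, Preadditive.sub_comp, Category.assoc, hr]; simp
      let e : A.mid ≅ X ⊞ Y :=
        { hom := biprod.lift A.p r
          inv := biprod.desc s A.i
          hom_inv_id := by rw [biprod.lift_desc, hs]; abel
          inv_hom_id := by ext <;> simp [h₁, h₂, hr, A.zero] }
      exact ⟨e, by ext <;> simp [e, B, A.zero, hr], by simp [e, B]⟩
    refine ⟨fun a b ↦ ?_⟩
    induction a, b using Quotient.inductionOn₂ with
    | h A A' => exact Quotient.sound (Setoid.trans (key A) (Setoid.symm (key A')))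

namespace IsFrobenius

variable (h : E.IsFrobenius)

/-- Extensions of `X` by `Y` are pullbacks of `Y ⟶ I ⟶ Ω⁻¹Y` along morphisms `X ⟶ Ω⁻¹Y`, and such a
pullback splits exactly when the morphism lifts to `I`, that is, when it is stably zero. -/
lemma ext1Vanishes_iff (X Y : C) : E.Ext1Vanishes X Y ↔
    ∀ f : E.toStable.obj X ⟶ h.suspension.obj (E.toStable.obj Y), f = 0 := by
  rw [ext1Vanishes_iff_exists_retraction]
  have hmono := mono_of_conflation (h.conflation_hull Y)
  constructor
  · intro H f
    obtain ⟨f, rfl⟩ := E.toStable.map_surjective (Y := h.cosyzygy Y) f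
    obtain ⟨Z, f', p, sq, -⟩ := E.deflation_pullback _ f
      (deflation_of_conflation (h.conflation_hull Y))
    obtain ⟨i, w, hi, hS⟩ := exists_conflation_of_isPullback (h.conflation_hull Y) sq
    have hp := epi_of_conflation hS
    obtain ⟨r, hr⟩ := H ⟨Z, i, p, w, hS⟩
    obtain ⟨s, hs⟩ := exists_desc_of_conflation hS (𝟙 _ - r ≫ i) (by
      rw [Preadditive.comp_sub, reassoc_of% hr, Category.comp_id, sub_self])
    refine (toStable_map_eq_zero_iff f).2 ⟨h.hull Y, s ≫ f', h.hullπ Y,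
      h.isProjective (h.isInjective_hull Y), ?_⟩
    rw [← cancel_epi p, Category.assoc, reassoc_of% hs, sq.w, Preadditive.sub_comp, Category.assoc,
      reassoc_of% w]
    simp
  · intro H A
    obtain ⟨z, hz⟩ := (h.isInjective_hull Y).exists_extend (inflation_of_conflation A.conflation)
      (h.hullι Y)
    obtain ⟨f, hf⟩ := exists_desc_of_conflation A.conflation (z ≫ h.hullπ Y) (by
      rw [reassoc_of% hz, h.hull_zero])
    obtain ⟨P, a, b, hP, rfl⟩ := (toStable_map_eq_zero_iff f).1 (H (E.toStable.map f))
    obtain ⟨b', rfl⟩ := hP.exists_lift (deflation_of_conflation (h.conflation_hull Y)) b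
    obtain ⟨r, hr⟩ := exists_lift_of_conflation (h.conflation_hull Y) (z - A.p ≫ a ≫ b') (by
      simp [hf])
    exact ⟨r, by
      rw [← cancel_mono (h.hullι Y), Category.assoc, hr, Preadditive.comp_sub, hz,
        reassoc_of% A.zero]; simp⟩

/-- Frees computations from the arbitrary choice in `cosyzygyMap`: any morphism of hull conflations
over `f` computes its suspension. -/
lemma suspension_map_eq {X Y : C} {f : X ⟶ Y} {g : h.cosyzygy X ⟶ h.cosyzygy Y}
    {a : h.hull X ⟶ h.hull Y} (ha : h.hullι X ≫ a = f ≫ h.hullι Y)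
    (hg : h.hullπ X ≫ g = a ≫ h.hullπ Y) :
    h.suspension.map (E.toStable.map f) = E.toStable.map g := by
  obtain ⟨a', ha', hg'⟩ := (h.exists_cosyzygyMap f).choose_spec
  exact (toStable_map_eq_iff _ _).2
    (h.stableRel_cosyzygy (Congruence.equivalence.refl f) ha' hg' ha hg)

/-! ### The suspension as an equivalence. -/

instance full_suspension : h.suspension.Full where
  map_surjective {X Y} g := by
    obtain ⟨X, rfl⟩ : ∃ X', E.toStable.obj X' = X := ⟨X.as, rfl⟩
    obtain ⟨Y, rfl⟩ : ∃ Y', E.toStable.obj Y' = Y := ⟨Y.as, rfl⟩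
    obtain ⟨g, rfl⟩ := E.toStable.map_surjective (X := h.cosyzygy X) (Y := h.cosyzygy Y) g
    -- The hull of `X` is also projective, so `g` lifts to the hulls and then restricts to the
    -- kernels.
    obtain ⟨a, ha⟩ := (h.isProjective (h.isInjective_hull X)).exists_lift
      (deflation_of_conflation (h.conflation_hull Y)) (h.hullπ X ≫ g)
    obtain ⟨f, hf⟩ := exists_lift_of_conflation (h.conflation_hull Y) (h.hullι X ≫ a) (by
      rw [Category.assoc, ha, reassoc_of% h.hull_zero X, zero_comp])
    exact ⟨E.toStable.map f, h.suspension_map_eq hf.symm ha.symm⟩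

instance additive_suspension : h.suspension.Additive where
  map_add {X Y f g} := by
    obtain ⟨X, rfl⟩ : ∃ X', E.toStable.obj X' = X := ⟨X.as, rfl⟩
    obtain ⟨Y, rfl⟩ : ∃ Y', E.toStable.obj Y' = Y := ⟨Y.as, rfl⟩
    obtain ⟨f, rfl⟩ := E.toStable.map_surjective f
    obtain ⟨g, rfl⟩ := E.toStable.map_surjective g
    obtain ⟨a, ha, hf⟩ := (h.exists_cosyzygyMap f).choose_spec
    obtain ⟨b, hb, hg⟩ := (h.exists_cosyzygyMap g).choose_spec
    exact h.suspension_map_eq (f := f + g) (g := h.cosyzygyMap f + h.cosyzygyMap g) (a := a + b)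
      (by simp [ha, hb])
      ((Preadditive.comp_add _ _ _ _ _ _).trans ((congrArg₂ _ hf hg).trans
        (Preadditive.add_comp _ _ _ _ _ _).symm))

instance faithful_suspension : h.suspension.Faithful where
  map_injective {X Y f₁ f₂} hf := by
    rw [← sub_eq_zero, ← Functor.map_sub] at hf
    rw [← sub_eq_zero]
    generalize f₁ - f₂ = f at hf ⊢
    obtain ⟨X, rfl⟩ : ∃ X', E.toStable.obj X' = X := ⟨X.as, rfl⟩
    obtain ⟨Y, rfl⟩ : ∃ Y', E.toStable.obj Y' = Y := ⟨Y.as, rfl⟩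
    obtain ⟨f, rfl⟩ := E.toStable.map_surjective f
    obtain ⟨g, a, ha, hg⟩ := h.exists_cosyzygyMap f
    rw [h.suspension_map_eq ha hg] at hf
    obtain ⟨P, u, t, hP, rfl⟩ := (toStable_map_eq_zero_iff g).1 hf
    obtain ⟨t', rfl⟩ := hP.exists_lift (deflation_of_conflation (h.conflation_hull Y)) t
    have hmono := mono_of_conflation (h.conflation_hull Y)
    obtain ⟨s, hs⟩ := exists_lift_of_conflation (h.conflation_hull Y) (a - h.hullπ X ≫ u ≫ t') (by
      simp [← hg])
    refine (toStable_map_eq_zero_iff f).2 ⟨h.hull X, h.hullι X, s,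
      h.isProjective (h.isInjective_hull X), ?_⟩
    rw [← cancel_mono (h.hullι Y), Category.assoc, hs, Preadditive.comp_sub, ha,
      reassoc_of% h.hull_zero X]
    simp

/-- The suspension of a syzygy of `X` is stably isomorphic to `X`. -/
lemma nonempty_suspensionIso {K P X : C} {i : K ⟶ P} {p : P ⟶ X} {w : i ≫ p = 0}
    (hS : E.conflation (ShortComplex.mk i p w)) (hP : E.IsProjective P) :
    Nonempty (h.suspension.obj (E.toStable.obj K) ≅ E.toStable.obj X) := by
  -- Schanuel's argument: the pushout `W` of the two embeddings of `K` is stably isomorphic to both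
  -- cokernels.
  obtain ⟨W, a, b, sq, -⟩ := E.inflation_pushout _ (h.hullι K) (inflation_of_conflation hS)
  have hI := h.isInjective_hull K
  obtain ⟨e₁⟩ := nonempty_stableIso_of_isPushout hS sq hI (h.isProjective hI)
  obtain ⟨e₂⟩ := nonempty_stableIso_of_isPushout (h.conflation_hull K) sq.flip
    (h.isInjective hP) hP
  exact ⟨e₂.symm ≪≫ e₁⟩

lemma exists_suspensionIso (M : E.StableCategory) :
    ∃ N : E.StableCategory, Nonempty (h.suspension.obj N ≅ M) := by
  obtain ⟨P, p, hP, K, i, w, hS⟩ := h.enough_projectives M.as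
  exact ⟨_, h.nonempty_suspensionIso hS hP⟩

end IsFrobenius

end Ext

end ExactStructure

namespace ExactStructure

/-! ### Cotorsion pairs and weight structures -/

section StableClosure

variable {C : Type u} [Category.{v} C] [Preadditive C] {E : ExactStructure C}

lemma stableImage_inverseImage (P : ObjectProperty E.StableCategory)
    [P.IsClosedUnderIsomorphisms] : E.stableImage (P.inverseImage E.toStable) = P := by
  ext M
  constructor
  · rintro ⟨X, hX, ⟨e⟩⟩
    exact P.prop_of_iso e hX
  · exact fun hM ↦ ⟨M.as, hM, ⟨Iso.refl _⟩⟩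

lemma stableClosure_eq_self {F : ObjectProperty C}
    (H : ∀ ⦃X Y : C⦄, (E.toStable.obj X ≅ E.toStable.obj Y) → F X → F Y) :
    E.stableClosure F = F := by
  ext X
  exact ⟨fun ⟨Y, hY, ⟨e⟩⟩ ↦ H e hY, F.prop_map_obj _⟩

end StableClosure

/-! ### Translation of each axiom to the stable category. -/

section WeightStructures

variable {C : Type u} [Category.{v} C] [Preadditive C] [HasZeroObject C] [HasBinaryBiproducts C]
  {E : ExactStructure C}

namespace IsFrobenius

variable (h : E.IsFrobenius)

lemma map_suspension_iff (Q : ObjectProperty E.StableCategory) [Q.IsClosedUnderIsomorphisms]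
    (N : E.StableCategory) : Q.map h.suspension (h.suspension.obj N) ↔ Q N := by
  refine ⟨?_, Q.prop_map_obj _⟩
  rintro ⟨N', hN', ⟨e⟩⟩
  exact Q.prop_of_iso (h.suspension.preimageIso e) hN'

lemma rightPerp_iff (P : ObjectProperty E.StableCategory) (Y : C) :
    E.rightPerp (P.inverseImage E.toStable) Y ↔
      P.rightOrthogonal (h.suspension.obj (E.toStable.obj Y)) := by
  simp only [rightPerp, h.ext1Vanishes_iff]
  exact ⟨fun H X f hX ↦ H X.as hX f, fun H X hX f ↦ H f hX⟩

lemma leftPerp_iff (Q : ObjectProperty E.StableCategory) (X : C) :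
    E.leftPerp (Q.inverseImage E.toStable) X ↔
      (Q.map h.suspension).leftOrthogonal (E.toStable.obj X) := by
  simp only [leftPerp, h.ext1Vanishes_iff]
  refine ⟨?_, fun H Y hY f ↦ H f (Q.prop_map_obj _ hY)⟩
  rintro H Z f ⟨Y, hY, ⟨e⟩⟩
  rw [← cancel_mono e.inv, zero_comp]
  exact H Y.as hY _

lemma isCotorsionPair_iff (P Q : ObjectProperty E.StableCategory) [Q.IsClosedUnderIsomorphisms] :
    E.IsCotorsionPair (P.inverseImage E.toStable) (Q.inverseImage E.toStable) ↔
      IsHomOrthogonalPair P (Q.map h.suspension) := by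
  constructor
  · refine fun H ↦ ⟨?_, ?_⟩
    · ext M
      obtain ⟨N, ⟨e⟩⟩ := h.exists_suspensionIso M
      rw [← P.rightOrthogonal.prop_iff_of_iso e, ← (Q.map h.suspension).prop_iff_of_iso e,
        h.map_suspension_iff]
      exact (h.rightPerp_iff P N.as).symm.trans (iff_of_eq (congrFun H.right_eq N.as))
    · ext M
      exact (iff_of_eq (congrFun H.left_eq M.as)).trans (h.leftPerp_iff Q M.as)
  · refine fun H ↦ ⟨?_, ?_⟩
    · ext Y
      rw [h.rightPerp_iff, H.right_eq, h.map_suspension_iff]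
      rfl
    · ext X
      rw [h.leftPerp_iff, ← H.left_eq]
      rfl

lemma syzygies_le_iff {P Q : ObjectProperty E.StableCategory} [P.IsClosedUnderIsomorphisms]
    [Q.IsClosedUnderIsomorphisms] (H : IsHomOrthogonalPair P (Q.map h.suspension)) :
    E.syzygies (P.inverseImage E.toStable) ≤ P.inverseImage E.toStable ↔
      Q.map h.suspension ≤ Q := by
  constructor
  -- By orthogonality it suffices to kill morphisms `X ⟶ N[2]` with `X` in `P`. Since `X` is stably
  -- `K[1]` for a syzygy `K` in `P`, each desuspends to a morphism `K ⟶ N[1]`, which vanishes.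
  · rintro H' M ⟨N, hN, ⟨e⟩⟩
    refine Q.prop_of_iso e ?_
    rw [← h.map_suspension_iff Q, ← H.right_eq]
    intro X f hX
    obtain ⟨B, p, hB, K, i, w, hS⟩ := h.enough_projectives X.as
    obtain ⟨e'⟩ := h.nonempty_suspensionIso hS hB
    have hK := H' K ⟨B, X.as, i, p, w, hS, hB, hX⟩
    have hzero : ∀ g : E.toStable.obj K ⟶ h.suspension.obj N, g = 0 := by
      rw [ObjectProperty.prop_inverseImage_iff, H.left_eq] at hK
      exact fun g ↦ hK g (Q.prop_map_obj _ hN)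
    obtain ⟨g, hg⟩ := h.suspension.map_surjective (e'.hom ≫ f)
    rw [← cancel_epi e'.hom, ← hg, hzero g, Functor.map_zero, comp_zero]
  · rintro H' K ⟨B, X, i, p, w, hS, hB, hX⟩
    obtain ⟨e⟩ := h.nonempty_suspensionIso hS hB
    rw [ObjectProperty.prop_inverseImage_iff, H.left_eq]
    rintro Z g hZ
    have hZ' : P.rightOrthogonal (h.suspension.obj Z) := by
      rw [H.right_eq, h.map_suspension_iff]
      exact H' _ hZ
    apply h.suspension.map_injective
    rw [Functor.map_zero, ← cancel_epi e.inv, comp_zero]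
    exact hZ' _ hX

lemma exists_triangle {P Q : ObjectProperty E.StableCategory} [P.IsClosedUnderIsomorphisms]
    (H : E.HasApproximations (P.inverseImage E.toStable) (Q.inverseImage E.toStable))
    (M : E.StableCategory) :
    ∃ (A B : E.StableCategory) (f : M ⟶ A) (g : A ⟶ B) (k : B ⟶ h.suspension.obj M),
      h.Distinguished (SuspensionTriangle.mk f g k) ∧ Q A ∧ P B := by
  obtain ⟨Y, X, i, p, w, hS, hX, hY⟩ := H.right M.as
  obtain ⟨K, g, j, sq, -⟩ := E.inflation_pushout i (h.hullι M.as) (inflation_of_conflation hS)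
  have hI := h.isInjective_hull M.as
  obtain ⟨e⟩ := nonempty_stableIso_of_isPushout hS sq hI (h.isProjective hI)
  obtain ⟨k, hgk, hjk⟩ := sq.exists_desc 0 (h.hullπ M.as) (by simp [h.hull_zero])
  exact ⟨E.toStable.obj Y, E.toStable.obj K, E.toStable.map i, E.toStable.map g,
    E.toStable.map k, ⟨M.as, Y, K, i, g, j, k, sq, hgk, hjk, Iso.refl _, Iso.refl _, Iso.refl _,
      (Category.comp_id _).trans (Category.id_comp _).symm,
      (Category.comp_id _).trans (Category.id_comp _).symm,
      by
        refine Eq.trans ?_ (Category.id_comp _).symm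
        refine (congrArg _ (h.suspension.map_id _)).trans (Category.comp_id _)⟩,
    hY, P.prop_of_iso e.symm hX⟩

/-- The second approximation sequences yield the first ones. -/
lemma hasApproximations_of_right (h : E.IsFrobenius) {P Q : ObjectProperty E.StableCategory}
    [P.IsClosedUnderIsomorphisms]
    (H : ∀ M : C, ∃ (Y' X' : C) (i : M ⟶ Y') (p : Y' ⟶ X') (w : i ≫ p = 0),
      E.conflation (ShortComplex.mk i p w) ∧ P.inverseImage E.toStable X' ∧
        Q.inverseImage E.toStable Y') :
    E.HasApproximations (P.inverseImage E.toStable) (Q.inverseImage E.toStable) where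
  left M := by
    obtain ⟨B, p, hB, N, i, w, hS⟩ := h.enough_projectives M
    obtain ⟨Y, X, i', p', w', hS', hX, hY⟩ := H N
    -- With `N` a syzygy of `M`, the pushout `Z` of `N ⟶ B` and `N ⟶ Y` sits in conflations `Y ⟶ Z ⟶
    -- M` and `B ⟶ Z ⟶ X`; the second makes `Z` stably isomorphic to `X`.
    obtain ⟨Z, a, b, sq, -⟩ := E.inflation_pushout i i' (inflation_of_conflation hS)
    obtain ⟨q, wq, -, hq⟩ := exists_conflation_of_isPushout hS sq
    obtain ⟨e⟩ := nonempty_stableIso_of_isPushout hS' sq.flip (h.isInjective hB) hB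
    exact ⟨Y, Z, b, q, wq, hq, P.prop_of_iso e.symm hX, hY⟩
  right := H

lemma hasApproximations_of_triangles {P Q : ObjectProperty E.StableCategory}
    [P.IsClosedUnderIsomorphisms] [Q.IsClosedUnderIsomorphisms]
    (H : ∀ M : E.StableCategory, ∃ (A B : E.StableCategory) (f : M ⟶ A) (g : A ⟶ B)
      (k : B ⟶ h.suspension.obj M),
        h.Distinguished (SuspensionTriangle.mk f g k) ∧ Q A ∧ P B) :
    E.HasApproximations (P.inverseImage E.toStable) (Q.inverseImage E.toStable) := by
  refine h.hasApproximations_of_right fun M ↦ ?_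
  obtain ⟨A, B, f₀, g₀, k₀, ⟨X, Y, K, f, g, j, k, sq, -, -, φ, ψ, χ, -⟩, hA, hB⟩ :=
    H (E.toStable.obj M)
  have hI := h.isProjective (h.isInjective_hull X)
  obtain ⟨e⟩ : Nonempty (E.toStable.obj (Y ⊞ h.hull X) ≅ E.toStable.obj Y) := by
    obtain ⟨e⟩ := nonempty_stableIso_biprod_of_isProjective hI Y
    exact ⟨E.toStable.mapIso (biprod.braiding _ _) ≪≫ e⟩
  obtain ⟨Y', K', i', p', w', hS, ⟨e₁⟩, ⟨e₂⟩⟩ := exists_conflation_of_stableIso h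
    (conflation_lift_of_isPushout (h.inflation_hullι X) sq) φ
  exact ⟨Y', K', i', p', w', hS, P.prop_of_iso (e₂ ≪≫ χ.symm).symm hB,
    Q.prop_of_iso (e₁ ≪≫ e ≪≫ ψ.symm).symm hA⟩

theorem isCompleteHereditaryCotorsionPair_iff (P Q : ObjectProperty E.StableCategory)
    [P.IsClosedUnderIsomorphisms] [Q.IsClosedUnderIsomorphisms] :
    E.IsCompleteHereditaryCotorsionPair (P.inverseImage E.toStable) (Q.inverseImage E.toStable) ↔
      h.IsStableWeightStructure Q P := by
  constructor
  · intro H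
    have hPQ := (h.isCotorsionPair_iff P Q).1 H.cotorsionPair
    exact ⟨inferInstance, hPQ, (h.syzygies_le_iff hPQ).1 H.hereditary,
      h.exists_triangle H.complete⟩
  · intro H
    exact ⟨(h.isCotorsionPair_iff P Q).2 H.orthogonal,
      h.hasApproximations_of_triangles H.exists_triangle,
      (h.syzygies_le_iff H.orthogonal).2 H.shift_le⟩

end IsFrobenius

/-- Vanishing of `Ext¹` is a condition on stable Hom groups, so a class defined by it is closed
under stable isomorphism. -/
lemma IsCotorsionPair.stableClosure_left_eq (h : E.IsFrobenius) {F T : ObjectProperty C}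
    (H : E.IsCotorsionPair F T) : E.stableClosure F = F :=
  stableClosure_eq_self fun X Y e hX ↦ by
    rw [H.left_eq] at hX ⊢
    refine fun Z hZ ↦ (h.ext1Vanishes_iff Y Z).2 fun f ↦ ?_
    rw [← cancel_epi e.hom, comp_zero]
    exact (h.ext1Vanishes_iff X Z).1 (hX Z hZ) _

lemma IsCotorsionPair.stableClosure_right_eq (h : E.IsFrobenius) {F T : ObjectProperty C}
    (H : E.IsCotorsionPair F T) : E.stableClosure T = T :=
  stableClosure_eq_self fun X Y e hX ↦ by
    rw [← H.right_eq] at hX ⊢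
    refine fun Z hZ ↦ (h.ext1Vanishes_iff Z Y).2 fun f ↦ ?_
    rw [← cancel_mono (h.suspension.map e.inv), zero_comp]
    exact (h.ext1Vanishes_iff Z X).1 (hX Z hZ) _

end WeightStructures

end ExactStructure

theorem mainTheorem7 {C : Type u} [Category.{v} C] [Preadditive C]
    [HasZeroObject C] [HasBinaryBiproducts C]
    (E : ExactStructure C) (h : E.IsFrobenius) :
    (∀ F T : ObjectProperty C,
      E.IsCompleteHereditaryCotorsionPair (E.stableClosure F) (E.stableClosure T) ↔
        h.IsStableWeightStructure (E.stableImage T) (E.stableImage F)) ∧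
    Set.BijOn
      (fun p : ObjectProperty C × ObjectProperty C ↦ (E.stableImage p.2, E.stableImage p.1))
      {p | E.IsCompleteHereditaryCotorsionPair p.1 p.2}
      {q | h.IsStableWeightStructure q.1 q.2} := by

  have key (F T : ObjectProperty C) :
      E.IsCompleteHereditaryCotorsionPair (E.stableClosure F) (E.stableClosure T) ↔
        h.IsStableWeightStructure (E.stableImage T) (E.stableImage F) :=
    h.isCompleteHereditaryCotorsionPair_iff _ _
  refine ⟨key, ?_, ?_, ?_⟩
  · rintro ⟨F, T⟩ H
    refine (key F T).1 ?_
    rwa [H.cotorsionPair.stableClosure_left_eq h, H.cotorsionPair.stableClosure_right_eq h]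
  · rintro ⟨F, T⟩ H ⟨F', T'⟩ H' e
    obtain ⟨hT, hF⟩ := Prod.mk.inj e
    refine Prod.ext ?_ ?_
    · exact (H.cotorsionPair.stableClosure_left_eq h).symm.trans
        ((congrArg (·.inverseImage E.toStable) hF).trans
          (H'.cotorsionPair.stableClosure_left_eq h))
    · exact (H.cotorsionPair.stableClosure_right_eq h).symm.trans
        ((congrArg (·.inverseImage E.toStable) hT).trans
          (H'.cotorsionPair.stableClosure_right_eq h))
  · rintro ⟨Q, P⟩ (H : h.IsStableWeightStructure Q P)
    have hQ : Q.IsClosedUnderIsomorphisms := H.isClosedUnderIsomorphisms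
    -- Closure is an axiom only for `Q`; `P` inherits it as a left orthogonal.
    have hP : P.IsClosedUnderIsomorphisms := by
      rw [H.orthogonal.left_eq]
      infer_instance
    exact ⟨(P.inverseImage E.toStable, Q.inverseImage E.toStable),
      (h.isCompleteHereditaryCotorsionPair_iff P Q).2 H,
      Prod.ext (ExactStructure.stableImage_inverseImage Q) (ExactStructure.stableImage_inverseImage P)⟩
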